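/- For an integer $n\ge 0$ let $J_n(x)=\sum_{k\ge 0}\frac{(-1)^k}{k!\,(k+n)!}\left(\frac{x}{2}\right)^{2k+n}$ denote the Bessel function of the first kind of order $n$. Let $j_{1,1}$ be the first positive root of $J_1$ and let $j_{0,2}$ be the second positive root of $J_0$. For every integer $m\ge 4$, the Wronskian $$\mathcal W_{1,m}=J_1J_m'-J_mJ_1'$$ has a smallest positive root $\mu_m>0$. This root is simple, i.e. $\mathcal W_{1,m}(\mu_m)=0\neq \mathcal W_{1,m}'(\mu_m)$; it is strictly decreasing in $m$, i.e. $\mu_k<\mu_m$ whenever $k>m\ge 4$; and it satisfies $$j_{1,1}<\mu_m<j_{0,2}.$$ -/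

import Mathlib

open scoped Nat

/-- The general term of the power series of the Bessel function `J_n`. -/
noncomputable def besselTerm (n : ℕ) (x : ℝ) (k : ℕ) : ℝ :=
  (-1) ^ k / ((k ! : ℝ) * ((k + n)! : ℝ)) * (x / 2) ^ (2 * k + n)

/-- The series of `J_n` converges (absolutely) at every real point. -/
theorem summable_besselTerm (n : ℕ) (x : ℝ) : Summable (besselTerm n x) := by
  have h := (Real.summable_pow_div_factorial ((x / 2) ^ 2)).mul_left (|x / 2| ^ n)
  refine Summable.of_norm_bounded h fun k => ?_
  have h1 : (1 : ℝ) ≤ ((k + n)! : ℝ) := by exact_mod_cast Nat.one_le_iff_ne_zero.2 (Nat.factorial_ne_zero _)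
  have h0 : (0 : ℝ) < (k ! : ℝ) := by exact_mod_cast Nat.factorial_pos k
  have e : ‖besselTerm n x k‖ =
      (|x / 2| ^ n * (((x / 2) ^ 2) ^ k / (k ! : ℝ))) / ((k + n)! : ℝ) := by
    rw [besselTerm, norm_mul, norm_div, norm_mul, norm_pow, norm_pow, norm_neg, norm_one, one_pow,
      Real.norm_of_nonneg h0.le, Real.norm_of_nonneg (zero_le_one.trans h1), Real.norm_eq_abs,
      pow_add, pow_mul, sq_abs]
    field_simp
  rw [e]
  exact div_le_self (by positivity) h1

/-- The Bessel function of the first kind of integer order `n ≥ 0`,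
`J_n(x) = ∑ₖ (-1)ᵏ / (k! (k + n)!) (x / 2)^(2 k + n)`, as a function of a real variable. -/
noncomputable def besselJ (n : ℕ) (x : ℝ) : ℝ := ∑' k : ℕ, besselTerm n x k

/-- The Wronskian `W_{k,l} = J_k J_l' - J_l J_k'`. -/
noncomputable def besselW (k l : ℕ) (x : ℝ) : ℝ :=
  besselJ k x * deriv (besselJ l) x - besselJ l x * deriv (besselJ k) x

/-- `x` is the `n`-th positive root of `f` (counted from `n = 1`, in increasing order):
`x` is a positive root, and exactly `n - 1` roots lie strictly between `0` and `x`. -/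
def IsNthPosRoot (f : ℝ → ℝ) (n : ℕ) (x : ℝ) : Prop :=
  0 < x ∧ f x = 0 ∧ {y : ℝ | 0 < y ∧ y < x ∧ f y = 0}.encard + 1 = (n : ℕ∞)

/-! Bessel's equation gives `(x W_{1,m})' = (m² - 1) J_1 J_m / x`. Up to `c = j_{0,2}` one has `J_m
> 0`, while `J_1` changes sign only at `j = j_{1,1}`; so `x W_{1,m}` rises from 0 on `[0, j]` and
falls strictly on `[j, c]`. Hence, once `W_{1,m}(c) < 0`, there is exactly one zero `μ_m` in `(0,
c)`, it lies beyond `j`, and the derivative there is nonzero.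

For `m = 4` the sign at `c` is a numerical check (`mul_besselW_one_four_neg`). The rest follows from
`besselW_succ_neg_of_eq_zero`: monotonicity of `J_{m+1} / J_m` forces `W_{1,m+1}(μ_m) < 0`, which
carries the sign at `c` from `m` to `m + 1` and also gives `μ_{m+1} < μ_m`.

Numerics use `u = x² / 4`. The bound `77/10` lies just above `c² / 4 ≈ 7.62`. -/

/-! ### Power series in `u = x² / 4`. -/

/-- The coefficients of the entire function `besselG n`. -/
noncomputable def besselGTerm (n : ℕ) (u : ℝ) (k : ℕ) : ℝ :=
  (-1) ^ k / ((k ! : ℝ) * ((k + n)! : ℝ)) * u ^ k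

/-- The entire function with `J_n(x) = (x / 2) ^ n * besselG n (x ^ 2 / 4)`. -/
noncomputable def besselG (n : ℕ) (u : ℝ) : ℝ := ∑' k : ℕ, besselGTerm n u k

theorem norm_besselGTerm_le (n : ℕ) (u : ℝ) (k : ℕ) :
    ‖besselGTerm n u k‖ ≤ |u| ^ k / (k ! : ℝ) := by
  have h1 : (1 : ℝ) ≤ ((k + n)! : ℝ) := by
    exact_mod_cast Nat.one_le_iff_ne_zero.2 (Nat.factorial_ne_zero _)
  have h0 : (0 : ℝ) < (k ! : ℝ) := by exact_mod_cast Nat.factorial_pos k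
  have e : ‖besselGTerm n u k‖ = (|u| ^ k / (k ! : ℝ)) / ((k + n)! : ℝ) := by
    rw [besselGTerm, norm_mul, norm_div, norm_mul, norm_pow, norm_pow, norm_neg, norm_one, one_pow,
      Real.norm_of_nonneg h0.le, Real.norm_of_nonneg (zero_le_one.trans h1), Real.norm_eq_abs]
    field_simp
  rw [e]
  exact div_le_self (by positivity) h1

theorem summable_besselGTerm (n : ℕ) (u : ℝ) : Summable (besselGTerm n u) :=
  (Real.summable_pow_div_factorial |u|).of_norm_bounded (norm_besselGTerm_le n u)

theorem besselGTerm_zero (n : ℕ) (u : ℝ) : besselGTerm n u 0 = 1 / (n ! : ℝ) := by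
  simp [besselGTerm]

theorem hasDerivAt_besselGTerm_succ (n k : ℕ) (u : ℝ) :
    HasDerivAt (fun v => besselGTerm n v (k + 1)) (-besselGTerm (n + 1) u k) u := by
  have h := (hasDerivAt_pow (k + 1) u).const_mul
    ((-1) ^ (k + 1) / (((k + 1)! : ℕ) * ((k + 1 + n)! : ℕ) : ℝ))
  refine h.congr_deriv ?_
  have e : k + (n + 1) = k + 1 + n := by ring
  rw [besselGTerm, e, Nat.factorial_succ k]
  have h0 : (k ! : ℝ) ≠ 0 := by exact_mod_cast Nat.factorial_ne_zero k
  have h1 : ((k + 1 + n)! : ℝ) ≠ 0 := by exact_mod_cast Nat.factorial_ne_zero _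
  have h2 : (k : ℝ) + 1 ≠ 0 := by positivity
  push_cast
  field_simp
  ring

theorem besselG_eq_add (n : ℕ) (u : ℝ) :
    besselG n u = 1 / (n ! : ℝ) + ∑' k, besselGTerm n u (k + 1) := by
  rw [besselG, (summable_besselGTerm n u).tsum_eq_zero_add, besselGTerm_zero]

theorem hasDerivAt_besselG (n : ℕ) (u : ℝ) :
    HasDerivAt (besselG n) (-besselG (n + 1) u) u := by
  have h : HasDerivAt (fun v => ∑' k, besselGTerm n v (k + 1))
      (∑' k, -besselGTerm (n + 1) u k) u := by
    refine hasDerivAt_tsum_of_isPreconnected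
      (Real.summable_pow_div_factorial (|u| + 1)) (t := Metric.ball 0 (|u| + 1))
      Metric.isOpen_ball (convex_ball _ _).isPreconnected
      (fun k v _ => hasDerivAt_besselGTerm_succ n k v) (fun k v hv => ?_)
      (y₀ := u) (by simp) ((summable_nat_add_iff 1).2 (summable_besselGTerm n u)) (by simp)
    rw [norm_neg]
    refine (norm_besselGTerm_le _ _ _).trans ?_
    have : |v| < |u| + 1 := by simpa using hv
    gcongr
  rw [tsum_neg] at h
  exact (h.const_add (1 / (n ! : ℝ))).congr_of_eventuallyEq
    (Filter.Eventually.of_forall fun v => besselG_eq_add n v)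

theorem continuous_besselG (n : ℕ) : Continuous (besselG n) :=
  continuous_iff_continuousAt.2 fun u => (hasDerivAt_besselG n u).continuousAt

theorem besselG_recurrence (n : ℕ) (u : ℝ) :
    besselG n u + u * besselG (n + 2) u = (n + 1) * besselG (n + 1) u := by
  have h : ∀ k, besselGTerm n u (k + 1) + u * besselGTerm (n + 2) u k
      = (n + 1) * besselGTerm (n + 1) u (k + 1) := by
    intro k
    have e1 : k + (n + 2) = (k + 1 + n) + 1 := by ring
    have e2 : k + 1 + (n + 1) = (k + 1 + n) + 1 := by ring
    rw [besselGTerm, besselGTerm, besselGTerm, e1, e2, Nat.factorial_succ k,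
      Nat.factorial_succ (k + 1 + n)]
    have h0 : (k ! : ℝ) ≠ 0 := by exact_mod_cast Nat.factorial_ne_zero k
    have h1 : ((k + 1 + n)! : ℝ) ≠ 0 := by exact_mod_cast Nat.factorial_ne_zero _
    have h2 : (k : ℝ) + 1 ≠ 0 := by positivity
    have h3 : (k : ℝ) + 1 + n + 1 ≠ 0 := by positivity
    push_cast
    field_simp
    ring
  have hs := (summable_nat_add_iff 1).2 (summable_besselGTerm n u)
  rw [besselG_eq_add n, besselG_eq_add (n + 1), besselG, ← tsum_mul_left, add_assoc,
    ← hs.tsum_add ((summable_besselGTerm (n + 2) u).mul_left u), tsum_congr h, tsum_mul_left,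
    mul_add, Nat.factorial_succ]
  have h1 : (n ! : ℝ) ≠ 0 := by exact_mod_cast Nat.factorial_ne_zero _
  congr 1
  push_cast
  field_simp

theorem besselJ_eq (n : ℕ) (x : ℝ) : besselJ n x = (x / 2) ^ n * besselG n (x ^ 2 / 4) := by
  rw [besselJ, besselG, ← tsum_mul_left]
  refine tsum_congr fun k => ?_
  have e : x ^ 2 / 4 = (x / 2) ^ 2 := by ring
  rw [besselTerm, besselGTerm, e, pow_add, pow_mul]
  ring

/-! ### Partial sums -/

theorem sum_range_le_tsum_of_pairs {f : ℕ → ℝ} (hf : Summable f) (N : ℕ)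
    (h : ∀ k, 0 ≤ f (2 * k + N) + f (2 * k + 1 + N)) : ∑ i ∈ Finset.range N, f i ≤ ∑' i, f i := by
  obtain ⟨g, hg⟩ : ∃ g : ℕ → ℝ, ∀ i, g i = f (i + N) := ⟨_, fun _ => rfl⟩
  simp only [← hg] at h
  have hs : Summable g := ((summable_nat_add_iff N).2 hf).congr fun i => (hg i).symm
  have he : Summable fun k => g (2 * k) :=
    hs.comp_injective (mul_right_injective₀ two_ne_zero)
  have ho : Summable fun k => g (2 * k + 1) :=
    hs.comp_injective ((add_left_injective 1).comp (mul_right_injective₀ two_ne_zero))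
  rw [← hf.sum_add_tsum_nat_add N, ← tsum_congr hg, ← tsum_even_add_odd he ho, ← he.tsum_add ho]
  exact le_add_of_nonneg_right (tsum_nonneg h)

/-- The last factor shows when a pair of terms has the sign of its first one, so partial sums bound
`besselG` as soon as `u ≤ (N + 1) * (N + 1 + n)`. -/
theorem besselGTerm_add_succ (n : ℕ) (u : ℝ) (k : ℕ) :
    besselGTerm n u k + besselGTerm n u (k + 1) =
      (-1) ^ k * (u ^ k / ((k + 1)! * (k + 1 + n)!) * ((k + 1) * (k + 1 + n) - u)) := by
  have e : k + 1 + n = k + n + 1 := by ring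
  rw [besselGTerm, besselGTerm, e, Nat.factorial_succ, Nat.factorial_succ]
  have h0 : (k ! : ℝ) ≠ 0 := by exact_mod_cast Nat.factorial_ne_zero k
  have h1 : ((k + n)! : ℝ) ≠ 0 := by exact_mod_cast Nat.factorial_ne_zero _
  have h2 : (k : ℝ) + 1 ≠ 0 := by positivity
  have h3 : (k : ℝ) + n + 1 ≠ 0 := by positivity
  push_cast
  field_simp
  ring

theorem besselG_pair_nonneg {n N k : ℕ} {u : ℝ} (hu : 0 ≤ u) (h : u ≤ (N + 1) * (N + 1 + n))
    (hk : N ≤ k) :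
    0 ≤ u ^ k / ((k + 1)! * (k + 1 + n)!) * (((k : ℝ) + 1) * (k + 1 + n) - u) := by
  have hk' : (N : ℝ) ≤ k := by exact_mod_cast hk
  refine mul_nonneg (by positivity) (sub_nonneg.2 (h.trans ?_))
  gcongr

theorem sum_range_le_besselG {n N : ℕ} (hN : Even N) {u : ℝ} (hu : 0 ≤ u)
    (h : u ≤ (N + 1) * (N + 1 + n)) :
    ∑ k ∈ Finset.range N, besselGTerm n u k ≤ besselG n u := by
  refine sum_range_le_tsum_of_pairs (summable_besselGTerm n u) N fun k => ?_
  have e : 2 * k + 1 + N = 2 * k + N + 1 := by ring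
  rw [e, besselGTerm_add_succ, Even.neg_one_pow ((even_two_mul k).add hN), one_mul]
  exact besselG_pair_nonneg hu h (by omega)

theorem besselG_le_sum_range {n N : ℕ} (hN : Odd N) {u : ℝ} (hu : 0 ≤ u)
    (h : u ≤ (N + 1) * (N + 1 + n)) :
    besselG n u ≤ ∑ k ∈ Finset.range N, besselGTerm n u k := by
  have key := sum_range_le_tsum_of_pairs (summable_besselGTerm n u).neg N fun k => ?_
  · rw [tsum_neg, Finset.sum_neg_distrib] at key
    exact neg_le_neg_iff.1 key
  have e : 2 * k + 1 + N = 2 * k + N + 1 := by ring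
  rw [e, ← neg_add, besselGTerm_add_succ, Odd.neg_one_pow ((even_two_mul k).add_odd hN),
    neg_one_mul, neg_neg]
  exact besselG_pair_nonneg hu h (by omega)

/-! ### Numerical sign estimates. -/

theorem besselG_zero_right_pos (n : ℕ) : 0 < besselG n 0 := by
  have h := sum_range_le_besselG (n := n) (N := 2) (by decide) le_rfl (by positivity)
  simp only [Finset.sum_range_succ, Finset.sum_range_zero, besselGTerm] at h
  refine lt_of_lt_of_le ?_ h
  have : 0 < (n ! : ℝ) := by exact_mod_cast Nat.factorial_pos n
  simpa using this

theorem besselG_one_four_neg : besselG 1 4 < 0 := by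
  have h := besselG_le_sum_range (n := 1) (N := 5) (by decide) (u := 4) (by norm_num) (by norm_num)
  refine h.trans_lt ?_
  norm_num [Finset.sum_range_succ, besselGTerm, Nat.factorial]

theorem besselG_zero_pos : 0 < besselG 0 (77 / 10) := by
  have h := sum_range_le_besselG (n := 0) (N := 8) (by decide) (u := 77 / 10) (by norm_num)
    (by norm_num)
  refine lt_of_lt_of_le ?_ h
  norm_num [Finset.sum_range_succ, besselGTerm, Nat.factorial]

theorem besselG_pos {m : ℕ} (hm : 4 ≤ m) {u : ℝ} (hu : 0 ≤ u) (hu' : u ≤ 77 / 10) :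
    0 < besselG m u := by
  have h := sum_range_le_besselG (n := m) (N := 4) (by decide) hu
    (hu'.trans (by have : (0 : ℝ) ≤ m := by positivity
                   push_cast; linarith))
  refine lt_of_lt_of_le ?_ h
  obtain ⟨s, rfl⟩ := Nat.exists_eq_add_of_le hm
  have h0 : 0 < ((4 + s)! : ℝ) := by exact_mod_cast Nat.factorial_pos _
  -- With `m = 4 + s`, the numerator is a polynomial in `s` whose coefficients are nonnegative for
  -- `u ≤ 77/10`; this settles all `m` at once.
  have e : ∑ k ∈ Finset.range 4, besselGTerm (4 + s) u k =
      ((210 - 42 * u + 7 / 2 * u ^ 2 - u ^ 3 / 6) + s * (107 - 13 * u + u ^ 2 / 2)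
        + s ^ 2 * (18 - u) + s ^ 3) / ((4 + s)! * ((5 + s) * (6 + s) * (7 + s))) := by
    have e1 : 1 + (4 + s) = (4 + s) + 1 := by ring
    have e2 : 2 + (4 + s) = (4 + s) + 1 + 1 := by ring
    have e3 : 3 + (4 + s) = (4 + s) + 1 + 1 + 1 := by ring
    have h5 : (5 : ℝ) + s ≠ 0 := by positivity
    have h6 : (6 : ℝ) + s ≠ 0 := by positivity
    have h7 : (7 : ℝ) + s ≠ 0 := by positivity
    have e5 : (4 : ℝ) + s + 1 = 5 + s := by ring
    have e6 : (5 : ℝ) + s + 1 = 6 + s := by ring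
    have e7 : (6 : ℝ) + s + 1 = 7 + s := by ring
    simp only [Finset.sum_range_succ, Finset.sum_range_zero, besselGTerm, e1, e2, e3,
      Nat.factorial_succ (4 + s), Nat.factorial_succ (4 + s + 1), Nat.factorial_succ (4 + s + 1 + 1),
      zero_add (4 + s)]
    push_cast
    rw [e5, e6, e7]
    norm_num [Nat.factorial]
    field_simp
    ring
  rw [e]
  have hs : (0 : ℝ) ≤ s := by positivity
  refine div_pos ?_ (by positivity)
  have p0 : 0 < 210 - 42 * u + 7 / 2 * u ^ 2 - u ^ 3 / 6 := by
    nlinarith [mul_nonneg (sub_nonneg.2 hu') (sq_nonneg (u - 6)), sq_nonneg (u - 6)]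
  have p1 : 0 ≤ 107 - 13 * u + u ^ 2 / 2 := by nlinarith [sq_nonneg (u - 13)]
  have p2 : 0 ≤ 18 - u := by linarith
  positivity

/-- This is the factor that decides the sign of `W_{1,4}` at a zero of `J_0`. -/
theorem five_mul_besselG_sub_pos {u : ℝ} (hu : 0 ≤ u) (hu' : u ≤ 77 / 10) :
    0 < 5 * besselG 4 u - 2 * u * besselG 5 u := by
  have h4 := sum_range_le_besselG (n := 4) (N := 6) (by decide) hu (hu'.trans (by norm_num))
  have h5 := besselG_le_sum_range (n := 5) (N := 5) (by decide) hu (hu'.trans (by norm_num))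
  have h5' := mul_le_mul_of_nonneg_left h5 (by positivity : 0 ≤ 2 * u)
  have key : 0 < 5 * ∑ k ∈ Finset.range 6, besselGTerm 4 u k
      - 2 * u * ∑ k ∈ Finset.range 5, besselGTerm 5 u k := by
    -- The quotient of the quintic in `key` by `77/10 - u`; the remainder, its value at `77/10`, is
    -- positive.
    have q : 0 ≤ 111365653 / 4147200000 - 1695511 / 414720000 * u + 81499 / 290304000 * u ^ 2
        - 313 / 29030400 * u ^ 3 + u ^ 4 / 2903040 := by
      nlinarith [sq_nonneg (u * (u - 313 / 20)), sq_nonneg (u - 52 / 5)]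
    have q' := mul_nonneg (sub_nonneg.2 hu') q
    norm_num [Finset.sum_range_succ, besselGTerm, Nat.factorial]
    nlinarith
  linarith

/-! ### Derivatives of Bessel functions and their Wronskians -/

open Set

theorem continuous_besselJ (n : ℕ) : Continuous (besselJ n) := by
  have h := continuous_besselG n
  rw [funext (besselJ_eq n)]
  fun_prop

theorem hasDerivAt_besselG_sq (n : ℕ) (x : ℝ) :
    HasDerivAt (fun y => besselG n (y ^ 2 / 4)) (-(x / 2 * besselG (n + 1) (x ^ 2 / 4))) x := by
  have h : HasDerivAt (fun y : ℝ => y ^ 2 / 4) (x / 2) x :=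
    ((hasDerivAt_pow 2 x).div_const 4).congr_deriv (by norm_num; ring)
  refine ((hasDerivAt_besselG n (x ^ 2 / 4)).comp x h).congr_deriv ?_
  ring

theorem hasDerivAt_besselJ_zero (x : ℝ) : HasDerivAt (besselJ 0) (-besselJ 1 x) x := by
  have e : besselJ 0 = fun y => besselG 0 (y ^ 2 / 4) := by
    funext y
    rw [besselJ_eq, pow_zero, one_mul]
  rw [e, besselJ_eq 1 x, pow_one]
  exact hasDerivAt_besselG_sq 0 x

theorem hasDerivAt_besselJ_succ (n : ℕ) (x : ℝ) :
    HasDerivAt (besselJ (n + 1))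
      ((n + 1) / 2 * (x / 2) ^ n * besselG (n + 1) (x ^ 2 / 4) - besselJ (n + 2) x) x := by
  have e : besselJ (n + 1) = fun y => (y / 2) ^ (n + 1) * besselG (n + 1) (y ^ 2 / 4) :=
    funext (besselJ_eq (n + 1))
  have h1 : HasDerivAt (fun y : ℝ => (y / 2) ^ (n + 1)) ((n + 1) / 2 * (x / 2) ^ n) x :=
    (((hasDerivAt_id' x).div_const 2).fun_pow (n + 1)).congr_deriv (by push_cast; simp; ring)
  rw [e, besselJ_eq (n + 2) x]
  exact (h1.mul (hasDerivAt_besselG_sq (n + 1) x)).congr_deriv (by ring)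

theorem differentiable_besselJ (n : ℕ) : Differentiable ℝ (besselJ n) := fun x => by
  cases n with
  | zero => exact (hasDerivAt_besselJ_zero x).differentiableAt
  | succ n => exact (hasDerivAt_besselJ_succ n x).differentiableAt

theorem mul_deriv_besselJ (n : ℕ) (x : ℝ) :
    x * deriv (besselJ n) x = n * besselJ n x - x * besselJ (n + 1) x := by
  cases n with
  | zero => simp [(hasDerivAt_besselJ_zero x).deriv]
  | succ n =>
    rw [(hasDerivAt_besselJ_succ n x).deriv, besselJ_eq (n + 1) x]
    push_cast
    ring

theorem mul_besselJ_recurrence (n : ℕ) (x : ℝ) :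
    x * (besselJ n x + besselJ (n + 2) x) = 2 * (n + 1) * besselJ (n + 1) x := by
  rw [besselJ_eq, besselJ_eq, besselJ_eq]
  linear_combination 2 * (x / 2) ^ (n + 1) * besselG_recurrence n (x ^ 2 / 4)

theorem hasDerivAt_mul_besselJ_succ (n : ℕ) (x : ℝ) :
    HasDerivAt (fun y => y * besselJ (n + 1) y) (x * besselJ n x - n * besselJ (n + 1) x) x := by
  refine ((hasDerivAt_id' x).mul
    (differentiable_besselJ (n + 1) x).hasDerivAt).congr_deriv ?_
  rw [mul_deriv_besselJ]
  push_cast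
  linear_combination -mul_besselJ_recurrence n x

/-- Bessel's differential equation in self-adjoint form. -/
theorem hasDerivAt_mul_deriv_besselJ (n : ℕ) {x : ℝ} (hx : x ≠ 0) :
    HasDerivAt (fun y => y * deriv (besselJ n) y) ((n ^ 2 / x - x) * besselJ n x) x := by
  rw [funext (mul_deriv_besselJ n)]
  refine (((differentiable_besselJ n x).hasDerivAt.const_mul (n : ℝ)).sub
    (hasDerivAt_mul_besselJ_succ n x)).congr_deriv ?_
  have h := mul_deriv_besselJ n x
  field_simp
  linear_combination (n : ℝ) * h

theorem mul_besselW (k l : ℕ) (x : ℝ) :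
    x * besselW k l x = besselJ k x * (x * deriv (besselJ l) x)
      - besselJ l x * (x * deriv (besselJ k) x) := by
  rw [besselW]
  ring

/-- Lagrange's identity: in the self-adjoint equations the terms free of the order cancel. -/
theorem hasDerivAt_mul_besselW (k l : ℕ) {x : ℝ} (hx : x ≠ 0) :
    HasDerivAt (fun y => y * besselW k l y)
      (((l : ℝ) ^ 2 - k ^ 2) * (besselJ k x * besselJ l x / x)) x := by
  rw [funext (mul_besselW k l)]
  have hk := (differentiable_besselJ k x).hasDerivAt
  have hl := (differentiable_besselJ l x).hasDerivAt
  refine ((hk.mul (hasDerivAt_mul_deriv_besselJ l hx)).sub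
    (hl.mul (hasDerivAt_mul_deriv_besselJ k hx))).congr_deriv ?_
  field_simp
  ring

theorem continuous_mul_besselW (k l : ℕ) : Continuous fun x => x * besselW k l x := by
  have hk := continuous_besselJ k
  have hl := continuous_besselJ l
  have hk' := continuous_besselJ (k + 1)
  have hl' := continuous_besselJ (l + 1)
  simp only [mul_besselW, mul_deriv_besselJ]
  fun_prop

theorem deriv_besselW_of_eq_zero {k l : ℕ} {x : ℝ} (hx : x ≠ 0) (h : besselW k l x = 0) :
    x * deriv (besselW k l) x = ((l : ℝ) ^ 2 - k ^ 2) * (besselJ k x * besselJ l x / x) := by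
  have h1 := hasDerivAt_mul_besselW k l hx
  have h2 : DifferentiableAt ℝ (besselW k l) x := by
    refine (h1.differentiableAt.fun_mul (differentiableAt_inv hx)).congr_of_eventuallyEq ?_
    filter_upwards [isOpen_ne.mem_nhds hx] with y hy
    have hy : y ≠ 0 := hy
    field_simp
  have h3 := ((hasDerivAt_id' x).mul h2.hasDerivAt).unique h1
  simpa [h] using h3

/-! ### First zeros -/

theorem exists_first_zero {f : ℝ → ℝ} (hf : Continuous f) {a b : ℝ} (hab : a ≤ b) (ha : 0 < f a)
    (hb : f b ≤ 0) : ∃ c, a < c ∧ c ≤ b ∧ f c = 0 ∧ ∀ x, a ≤ x → x < c → 0 < f x := by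
  have hK : IsCompact (Icc a b ∩ f ⁻¹' {0}) :=
    isCompact_Icc.inter_right (isClosed_singleton.preimage hf)
  have hne : (Icc a b ∩ f ⁻¹' {0}).Nonempty := by
    obtain ⟨x, hx, h⟩ := intermediate_value_Icc' hab hf.continuousOn ⟨hb, ha.le⟩
    exact ⟨x, hx, h⟩
  obtain ⟨c, ⟨hc, hc0⟩, hmin⟩ := hK.exists_isLeast hne
  have hc0 : f c = 0 := hc0
  refine ⟨c, lt_of_le_of_ne hc.1 (by rintro rfl; exact ha.ne' hc0), hc.2, hc0, fun x hax hxc => ?_⟩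
  by_contra! hneg
  obtain ⟨y, hy, h⟩ := intermediate_value_Icc' hax hf.continuousOn ⟨hneg, ha.le⟩
  exact absurd (hmin ⟨⟨hy.1, hy.2.trans (hxc.le.trans hc.2)⟩, h⟩) (not_le.2 (hy.2.trans_lt hxc))

theorem besselJ_one_first_zero :
    ∃ j, 0 < j ∧ j ≤ 4 ∧ besselJ 1 j = 0 ∧ ∀ x, 0 < x → x < j → 0 < besselJ 1 x := by
  have hc : Continuous fun x : ℝ => besselG 1 (x ^ 2 / 4) :=
    (continuous_besselG 1).comp (by fun_prop)
  obtain ⟨c, h0, h4, hz, hp⟩ := exists_first_zero hc (zero_le_four (α := ℝ))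
    (by simpa using besselG_zero_right_pos 1) (by
      have h : (4 : ℝ) ^ 2 / 4 = 4 := by norm_num
      rw [h]
      exact besselG_one_four_neg.le)
  refine ⟨c, h0, h4, by simp [besselJ_eq, hz], fun x hx hxc => ?_⟩
  have := hp x hx.le hxc
  rw [besselJ_eq]
  positivity

theorem isNthPosRoot_one {f : ℝ → ℝ} {j : ℝ} (hj : 0 < j) (h : f j = 0)
    (hne : ∀ x, 0 < x → x < j → f x ≠ 0) : IsNthPosRoot f 1 j := by
  refine ⟨hj, h, ?_⟩
  have e : {y : ℝ | 0 < y ∧ y < j ∧ f y = 0} = ∅ :=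
    eq_empty_of_forall_notMem fun y hy => hne y hy.1 hy.2.1 hy.2.2
  simp [e]

theorem isNthPosRoot_two {f : ℝ → ℝ} {i j : ℝ} (hi : 0 < i) (hij : i < j) (hfi : f i = 0)
    (hfj : f j = 0) (h : ∀ x, 0 < x → x < j → f x = 0 → x = i) : IsNthPosRoot f 2 j := by
  refine ⟨hi.trans hij, hfj, ?_⟩
  have e : {y : ℝ | 0 < y ∧ y < j ∧ f y = 0} = {i} := by
    ext y
    constructor
    · rintro ⟨h1, h2, h3⟩
      exact h y h1 h2 h3
    · rintro rfl
      exact ⟨hi, hij, hfi⟩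
  rw [e, encard_singleton]
  norm_num

theorem strictAntiOn_of_hasDerivAt_neg {f f' : ℝ → ℝ} {a b : ℝ} (hf : ContinuousOn f (Icc a b))
    (hd : ∀ x, a < x → x < b → HasDerivAt f (f' x) x) (hneg : ∀ x, a < x → x < b → f' x < 0) :
    StrictAntiOn f (Icc a b) := by
  refine strictAntiOn_of_deriv_neg (convex_Icc a b) hf fun x hx => ?_
  rw [interior_Icc] at hx
  rw [(hd x hx.1 hx.2).deriv]
  exact hneg x hx.1 hx.2

theorem strictMonoOn_of_hasDerivAt_pos {f f' : ℝ → ℝ} {a b : ℝ} (hf : ContinuousOn f (Icc a b))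
    (hd : ∀ x, a < x → x < b → HasDerivAt f (f' x) x) (hpos : ∀ x, a < x → x < b → 0 < f' x) :
    StrictMonoOn f (Icc a b) := by
  refine strictMonoOn_of_deriv_pos (convex_Icc a b) hf fun x hx => ?_
  rw [interior_Icc] at hx
  rw [(hd x hx.1 hx.2).deriv]
  exact hpos x hx.1 hx.2

theorem hasDerivAt_mul_besselJ_one (x : ℝ) :
    HasDerivAt (fun y => y * besselJ 1 y) (x * besselJ 0 x) x := by
  simpa using hasDerivAt_mul_besselJ_succ 0 x

theorem continuous_mul_besselJ (n : ℕ) : Continuous fun x => x * besselJ n x :=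
  continuous_id.mul (continuous_besselJ n)

theorem besselJ_zero_zero_pos : 0 < besselJ 0 0 := by
  simpa [besselJ_eq] using besselG_zero_right_pos 0

theorem besselJ_zero_strictAntiOn {j : ℝ} (hpos : ∀ x, 0 < x → x < j → 0 < besselJ 1 x) :
    StrictAntiOn (besselJ 0) (Icc 0 j) :=
  strictAntiOn_of_hasDerivAt_neg (continuous_besselJ 0).continuousOn
    (fun x _ _ => hasDerivAt_besselJ_zero x) fun x h0 h1 => neg_neg_of_pos (hpos x h0 h1)

/-- Otherwise `J_0 > 0` on `(0, j)`, and `(y J_1)' = y J_0` would make `y J_1` increase strictly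
from 0 to 0. -/
theorem besselJ_zero_neg_of_first_zero {j : ℝ} (hj : 0 < j) (hz : besselJ 1 j = 0)
    (hpos : ∀ x, 0 < x → x < j → 0 < besselJ 1 x) : besselJ 0 j < 0 := by
  by_contra! hneg
  have hanti := besselJ_zero_strictAntiOn hpos
  have hmono : StrictMonoOn (fun y => y * besselJ 1 y) (Icc 0 j) :=
    strictMonoOn_of_hasDerivAt_pos (continuous_mul_besselJ 1).continuousOn
      (fun x _ _ => hasDerivAt_mul_besselJ_one x) fun x h0 h1 => mul_pos h0
        (hneg.trans_lt (hanti ⟨h0.le, h1.le⟩ ⟨hj.le, le_rfl⟩ h1))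
  have := hmono ⟨le_rfl, hj.le⟩ ⟨hj.le, le_rfl⟩ hj
  simp [hz] at this

/-- The first zero `j` of `J_1`, the second zero `c` of `J_0`, and the sign of `J_1` up to `c`. -/
theorem exists_besselJ_zeros : ∃ j c : ℝ, IsNthPosRoot (besselJ 1) 1 j ∧
    IsNthPosRoot (besselJ 0) 2 c ∧ j < c ∧ c ^ 2 / 4 ≤ 77 / 10 ∧
    (∀ x, 0 < x → x < j → 0 < besselJ 1 x) ∧ (∀ x, j < x → x ≤ c → besselJ 1 x < 0) := by
  obtain ⟨j, hj, hj4, hz, hpos⟩ := besselJ_one_first_zero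
  have hneg := besselJ_zero_neg_of_first_zero hj hz hpos
  have hanti := besselJ_zero_strictAntiOn hpos
  obtain ⟨i, hi, hij, hzi, -⟩ := exists_first_zero (continuous_besselJ 0) hj.le
    besselJ_zero_zero_pos hneg.le
  -- `√(154/5)` is the point `x` with `x² / 4 = 77/10`.
  have hs : √(154 / 5 : ℝ) ^ 2 = 154 / 5 := Real.sq_sqrt (by norm_num)
  have hjs : j ≤ √(154 / 5 : ℝ) := hj4.trans (Real.le_sqrt_of_sq_le (by norm_num))
  obtain ⟨c, hjc, hcs, hzc, hnegc⟩ := exists_first_zero (continuous_besselJ 0).neg hjs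
    (neg_pos.2 hneg) (by
      have e : √(154 / 5 : ℝ) ^ 2 / 4 = 77 / 10 := by rw [hs]; norm_num
      rw [Pi.neg_apply, besselJ_eq, e, pow_zero, one_mul]
      exact neg_nonpos.2 besselG_zero_pos.le)
  have hzc : besselJ 0 c = 0 := neg_eq_zero.1 hzc
  refine ⟨j, c, isNthPosRoot_one hj hz fun x h0 h1 => (hpos x h0 h1).ne', ?_, hjc, ?_, hpos, ?_⟩
  · refine isNthPosRoot_two hi (hij.trans_lt hjc) hzi hzc fun x h0 hxc hx => ?_
    have hxj : x ≤ j := by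
      by_contra! hlt
      exact (neg_pos.1 (hnegc x hlt.le hxc)).ne hx
    exact hanti.injOn ⟨h0.le, hxj⟩ ⟨hi.le, hij⟩ (hx.trans hzi.symm)
  · have : c ^ 2 ≤ 154 / 5 := hs ▸ pow_le_pow_left₀ (hj.le.trans hjc.le) hcs 2
    linarith
  · intro x hjx hxc
    have h : StrictAntiOn (fun y => y * besselJ 1 y) (Icc j c) :=
      strictAntiOn_of_hasDerivAt_neg (continuous_mul_besselJ 1).continuousOn
        (fun x _ _ => hasDerivAt_mul_besselJ_one x) fun x h0 h1 =>
          mul_neg_of_pos_of_neg (hj.trans h0) (neg_pos.1 (hnegc x h0.le h1))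
    have h1 := h ⟨le_rfl, hjc.le⟩ ⟨hjx.le, hxc⟩ hjx
    simp only [hz, mul_zero] at h1
    exact (pos_iff_neg_of_mul_neg h1).1 (hj.trans hjx)

theorem sq_div_four_le {c x : ℝ} (hc : c ^ 2 / 4 ≤ 77 / 10) (h0 : 0 < x) (hx : x ≤ c) :
    x ^ 2 / 4 ≤ 77 / 10 :=
  le_trans (by gcongr) hc

theorem besselJ_pos {m : ℕ} (hm : 4 ≤ m) {x : ℝ} (h0 : 0 < x) (hx : x ^ 2 / 4 ≤ 77 / 10) :
    0 < besselJ m x := by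
  rw [besselJ_eq]
  have := besselG_pos hm (by positivity) hx
  positivity

/-! ### Zeros of the Wronskian -/

/-- Since `J_0(c) = 0`, the recurrence gives `c J_2 = 2 J_1`, and `c W_{1,4}` becomes `J_1 (5 J_4 -
c J_5)` at `c`. -/
theorem mul_besselW_one_four_neg {c : ℝ} (hc : 0 < c) (hc' : c ^ 2 / 4 ≤ 77 / 10)
    (h0 : besselJ 0 c = 0) (h1 : besselJ 1 c < 0) : c * besselW 1 4 c < 0 := by
  have hr := mul_besselJ_recurrence 0 c
  have e : c * besselW 1 4 c = besselJ 1 c * ((c / 2) ^ 4 *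
      (5 * besselG 4 (c ^ 2 / 4) - 2 * (c ^ 2 / 4) * besselG 5 (c ^ 2 / 4))) := by
    rw [mul_besselW, mul_deriv_besselJ, mul_deriv_besselJ, besselJ_eq 4, besselJ_eq 5]
    simp only [h0] at hr
    norm_num at hr ⊢
    linear_combination (c / 2) ^ 4 * besselG 4 (c ^ 2 / 4) * hr
  have := five_mul_besselG_sub_pos (u := c ^ 2 / 4) (by positivity) hc'
  rw [e]
  exact mul_neg_of_neg_of_pos h1 (by positivity)

/-- The derivative of the ratio has the sign of `W_{m,m+1}`, and `z W_{m,m+1}` increases from 0. -/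
theorem besselJ_ratio_lt {m : ℕ} (hm : 4 ≤ m) {c x y : ℝ} (hc : c ^ 2 / 4 ≤ 77 / 10) (h0 : 0 < x)
    (hxy : x < y) (hy : y ≤ c) :
    besselJ (m + 1) x / besselJ m x < besselJ (m + 1) y / besselJ m y := by
  have hp : ∀ {n : ℕ}, 4 ≤ n → ∀ z, 0 < z → z ≤ c → 0 < besselJ n z := fun hn z h1 h2 =>
    besselJ_pos hn h1 (sq_div_four_le hc h1 h2)
  have hW : ∀ z, 0 < z → z < c → 0 < besselW m (m + 1) z := by
    intro z hz hzc
    have h : StrictMonoOn (fun y => y * besselW m (m + 1) y) (Icc 0 c) :=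
      strictMonoOn_of_hasDerivAt_pos (continuous_mul_besselW _ _).continuousOn
        (fun w h1 _ => hasDerivAt_mul_besselW m (m + 1) h1.ne') fun w h1 h2 => by
          have a := hp hm w h1 h2.le
          have b := hp (hm.trans m.le_succ) w h1 h2.le
          have d : (0 : ℝ) < ((m + 1 : ℕ) : ℝ) ^ 2 - (m : ℝ) ^ 2 := by
            push_cast; ring_nf; positivity
          positivity
    have := h ⟨le_rfl, hz.le.trans hzc.le⟩ ⟨hz.le, hzc.le⟩ hz
    simp only [zero_mul] at this
    exact (pos_iff_pos_of_mul_pos this).1 hz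
  have hd : ∀ z, 0 < z → z ≤ c → HasDerivAt (fun w => besselJ (m + 1) w / besselJ m w)
      (besselW m (m + 1) z / besselJ m z ^ 2) z := fun z h1 h2 =>
    ((differentiable_besselJ (m + 1) z).hasDerivAt.div (differentiable_besselJ m z).hasDerivAt
      (hp hm z h1 h2).ne').congr_deriv (by rw [besselW]; ring)
  have h : StrictMonoOn (fun w => besselJ (m + 1) w / besselJ m w) (Icc x y) :=
    strictMonoOn_of_hasDerivAt_pos
      (fun z hz => (hd z (h0.trans_le hz.1) (hz.2.trans hy)).continuousAt.continuousWithinAt)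
      (fun z h1 h2 => hd z (h0.trans h1) (h2.le.trans hy)) fun z h1 h2 =>
        div_pos (hW z (h0.trans h1) (h2.trans_le hy))
          (pow_pos (hp hm z (h0.trans h1) (h2.le.trans hy)) 2)
  exact h ⟨le_rfl, hxy.le⟩ ⟨hxy.le, le_rfl⟩ hxy

theorem strictAntiOn_mul_besselW_one {j c : ℝ} (hj : 0 < j) (hc : c ^ 2 / 4 ≤ 77 / 10)
    (hneg : ∀ x, j < x → x ≤ c → besselJ 1 x < 0) {m : ℕ} (hm : 4 ≤ m) :
    StrictAntiOn (fun y => y * besselW 1 m y) (Icc j c) :=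
  strictAntiOn_of_hasDerivAt_neg (continuous_mul_besselW _ _).continuousOn
    (fun w h1 _ => hasDerivAt_mul_besselW 1 m (hj.trans h1).ne') fun w h1 h2 =>
      mul_neg_of_pos_of_neg
        (by
          have : (4 : ℝ) ≤ m := by exact_mod_cast hm
          push_cast
          nlinarith)
        (div_neg_of_neg_of_pos (mul_neg_of_neg_of_pos (hneg w h1 h2.le)
          (besselJ_pos hm (hj.trans h1) (sq_div_four_le hc (hj.trans h1) h2.le))) (hj.trans h1))

theorem exists_besselW_zero {j c : ℝ} (hj : 0 < j) (hjc : j < c) (hc : c ^ 2 / 4 ≤ 77 / 10)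
    (hpos : ∀ x, 0 < x → x < j → 0 < besselJ 1 x) (hneg : ∀ x, j < x → x ≤ c → besselJ 1 x < 0)
    {m : ℕ} (hm : 4 ≤ m) (hcm : c * besselW 1 m c < 0) :
    ∃ μ, j < μ ∧ μ < c ∧ besselW 1 m μ = 0 ∧ (∀ x, 0 < x → x < μ → 0 < besselW 1 m x) ∧
      ∀ x, μ < x → x ≤ c → besselW 1 m x < 0 := by
  have hp : ∀ z, 0 < z → z ≤ c → 0 < besselJ m z := fun z h1 h2 =>
    besselJ_pos hm h1 (sq_div_four_le hc h1 h2)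
  have hm1 : (0 : ℝ) < (m : ℝ) ^ 2 - (1 : ℕ) ^ 2 := by
    have : (4 : ℝ) ≤ m := by exact_mod_cast hm
    push_cast
    nlinarith
  have hmono : StrictMonoOn (fun y => y * besselW 1 m y) (Icc 0 j) :=
    strictMonoOn_of_hasDerivAt_pos (continuous_mul_besselW _ _).continuousOn
      (fun w h1 _ => hasDerivAt_mul_besselW 1 m h1.ne') fun w h1 h2 => by
        have a := hp w h1 (h2.le.trans hjc.le)
        have b := hpos w h1 h2
        positivity
  have hanti := strictAntiOn_mul_besselW_one hj hc hneg hm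
  have hup : ∀ x, 0 < x → x ≤ j → 0 < besselW 1 m x := fun x h1 h2 => by
    have := hmono ⟨le_rfl, hj.le⟩ ⟨h1.le, h2⟩ h1
    simp only [zero_mul] at this
    exact (pos_iff_pos_of_mul_pos this).1 h1
  obtain ⟨μ, h1, h2, h3, h4⟩ := exists_first_zero (continuous_mul_besselW 1 m) hjc.le
    (mul_pos hj (hup j hj le_rfl)) hcm.le
  refine ⟨μ, h1, lt_of_le_of_ne h2 ?_, (mul_eq_zero.1 h3).resolve_left (hj.trans h1).ne',
    fun x hx hxμ => ?_, fun x hx hxc => ?_⟩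
  · rintro rfl
    exact hcm.ne h3
  · rcases le_or_gt x j with hxj | hxj
    · exact hup x hx hxj
    · exact (pos_iff_pos_of_mul_pos (h4 x hxj.le hxμ)).1 hx
  · have := hanti ⟨h1.le, h2⟩ ⟨h1.le.trans hx.le, hxc⟩ hx
    simp only [h3] at this
    exact (pos_iff_neg_of_mul_neg this).1 (hj.trans (h1.trans hx))

theorem besselW_succ_neg_of_eq_zero {j c : ℝ} (hj : 0 < j) (hjc : j < c) (hc : c ^ 2 / 4 ≤ 77 / 10)
    (hpos : ∀ x, 0 < x → x < j → 0 < besselJ 1 x) (hneg : ∀ x, j < x → x ≤ c → besselJ 1 x < 0)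
    {m : ℕ} (hm : 4 ≤ m) {μ : ℝ} (hjμ : j < μ) (hμc : μ ≤ c)
    (hμ : besselW 1 m μ = 0) : besselW 1 (m + 1) μ < 0 := by
  have hp : ∀ z, 0 < z → z ≤ c → 0 < besselJ m z := fun z h1 h2 =>
    besselJ_pos hm h1 (sq_div_four_le hc h1 h2)
  have hm4 : (4 : ℝ) ≤ m := by exact_mod_cast hm
  have hm1 : (0 : ℝ) < (m : ℝ) ^ 2 - (1 : ℕ) ^ 2 := by
    push_cast
    nlinarith
  have hm2 : (0 : ℝ) < ((m + 1 : ℕ) : ℝ) ^ 2 - (1 : ℕ) ^ 2 := by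
    push_cast
    nlinarith
  -- With this `r`, `J_{m+1} - r J_m` changes sign at `j`, opposite to `J_1`, so their product is
  -- negative on both sides of `j`.
  obtain ⟨r, hr⟩ : ∃ r, r = besselJ (m + 1) j / besselJ m j := ⟨_, rfl⟩
  have hlt : ∀ x, 0 < x → x < j → besselJ (m + 1) x - r * besselJ m x < 0 := fun x h1 h2 => by
    have h := besselJ_ratio_lt hm hc h1 h2 hjc.le
    rw [← hr, div_lt_iff₀ (hp x h1 (h2.le.trans hjc.le))] at h
    exact sub_neg.2 h
  have hgt : ∀ x, j < x → x ≤ c → 0 < besselJ (m + 1) x - r * besselJ m x := fun x h1 h2 => by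
    have h := besselJ_ratio_lt hm hc hj h1 h2
    rw [← hr, lt_div_iff₀ (hp x (hj.trans h1) h2)] at h
    exact sub_pos.2 h
  -- `B` is the primitive of `J_1 (J_{m+1} - r J_m) / x` vanishing at 0; at `μ` its second term
  -- vanishes.
  obtain ⟨B, hB⟩ : ∃ B : ℝ → ℝ, B = fun x =>
      x * besselW 1 (m + 1) x / (((m + 1 : ℕ) : ℝ) ^ 2 - (1 : ℕ) ^ 2)
        - r * (x * besselW 1 m x / ((m : ℝ) ^ 2 - (1 : ℕ) ^ 2)) := ⟨_, rfl⟩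
  have hBc : Continuous B := by
    rw [hB]
    exact ((continuous_mul_besselW _ _).div_const _).sub
      (((continuous_mul_besselW _ _).div_const _).const_mul r)
  have hBd : ∀ x, 0 < x →
      HasDerivAt B (besselJ 1 x * (besselJ (m + 1) x - r * besselJ m x) / x) x := by
    intro x hx
    rw [hB]
    refine (((hasDerivAt_mul_besselW 1 (m + 1) hx.ne').div_const _).sub
      (((hasDerivAt_mul_besselW 1 m hx.ne').div_const _).const_mul r)).congr_deriv ?_
    rw [mul_div_cancel_left₀ _ hm1.ne', mul_div_cancel_left₀ _ hm2.ne']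
    ring
  have h1 : B j < B 0 := strictAntiOn_of_hasDerivAt_neg hBc.continuousOn
    (fun x h1 _ => hBd x h1) (fun x h1 h2 => div_neg_of_neg_of_pos
      (mul_neg_of_pos_of_neg (hpos x h1 h2) (hlt x h1 h2)) h1) ⟨le_rfl, hj.le⟩ ⟨hj.le, le_rfl⟩ hj
  have h2 : B μ < B j := strictAntiOn_of_hasDerivAt_neg hBc.continuousOn
    (fun x h1 _ => hBd x (hj.trans h1)) (fun x h1 h2 => div_neg_of_neg_of_pos
      (mul_neg_of_neg_of_pos (hneg x h1 (h2.le.trans hμc)) (hgt x h1 (h2.le.trans hμc)))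
      (hj.trans h1)) ⟨le_rfl, hjμ.le⟩ ⟨hjμ.le, le_rfl⟩ hjμ
  have h3 := h2.trans h1
  simp only [hB, hμ, mul_zero, zero_mul, zero_div, sub_zero] at h3
  have h4 : μ * besselW 1 (m + 1) μ < 0 := by
    by_contra! h
    exact h3.not_ge (div_nonneg h hm2.le)
  exact (pos_iff_neg_of_mul_neg h4).1 (hj.trans hjμ)

theorem mul_besselW_one_neg {j c : ℝ} (hj : 0 < j) (hjc : j < c) (hc : c ^ 2 / 4 ≤ 77 / 10)
    (hpos : ∀ x, 0 < x → x < j → 0 < besselJ 1 x) (hneg : ∀ x, j < x → x ≤ c → besselJ 1 x < 0)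
    (h4 : c * besselW 1 4 c < 0) {m : ℕ} (hm : 4 ≤ m) :
    c * besselW 1 m c < 0 := by
  induction m, hm using Nat.le_induction with
  | base => exact h4
  | succ m hm ih =>
    obtain ⟨μ, h1, h2, h3, -, -⟩ := exists_besselW_zero hj hjc hc hpos hneg hm ih
    by_contra! h
    have hμ := besselW_succ_neg_of_eq_zero hj hjc hc hpos hneg hm h1 h2.le h3
    have hanti := strictAntiOn_mul_besselW_one hj hc hneg (hm.trans m.le_succ)
    have := hanti ⟨h1.le, h2.le⟩ ⟨hjc.le, le_rfl⟩ h2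
    exact (this.trans (mul_neg_of_pos_of_neg (hj.trans h1) hμ)).not_ge h

theorem lemma1p1 :
    ∃ j₁₁ j₀₂ : ℝ, IsNthPosRoot (besselJ 1) 1 j₁₁ ∧ IsNthPosRoot (besselJ 0) 2 j₀₂ ∧
      ∃ μ : ℕ → ℝ,
        (∀ m : ℕ, 4 ≤ m →
          IsLeast {x : ℝ | 0 < x ∧ besselW 1 m x = 0} (μ m) ∧
          deriv (besselW 1 m) (μ m) ≠ 0 ∧
          j₁₁ < μ m ∧ μ m < j₀₂) ∧
        (∀ m k : ℕ, 4 ≤ m → m < k → μ k < μ m) := by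
  obtain ⟨j, c, hj, hc, hjc, hc', hpos, hneg⟩ := exists_besselJ_zeros
  have h4 := mul_besselW_one_four_neg hc.1 hc' hc.2.1 (hneg c hjc le_rfl)
  have hex : ∀ m, ∃ μ, 4 ≤ m → j < μ ∧ μ < c ∧ besselW 1 m μ = 0 ∧
      (∀ x, 0 < x → x < μ → 0 < besselW 1 m x) ∧ ∀ x, μ < x → x ≤ c → besselW 1 m x < 0 := by
    intro m
    by_cases hm : 4 ≤ m
    · obtain ⟨μ, h⟩ := exists_besselW_zero hj.1 hjc hc' hpos hneg hm
        (mul_besselW_one_neg hj.1 hjc hc' hpos hneg h4 hm)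
      exact ⟨μ, fun _ => h⟩
    -- An arbitrary value for `m < 4`.
    · exact ⟨0, fun h => absurd h hm⟩
  choose μ hμ using hex
  refine ⟨j, c, hj, hc, μ, fun m hm => ?_, fun m k hm hmk => ?_⟩
  · obtain ⟨h1, h2, h3, h5, -⟩ := hμ m hm
    have hμ0 := hj.1.trans h1
    refine ⟨⟨⟨hμ0, h3⟩, fun x hx => ?_⟩, fun hd => ?_, h1, h2⟩
    · by_contra! hlt
      exact (h5 x hx.1 hlt).ne' hx.2
    · have e := deriv_besselW_of_eq_zero hμ0.ne' h3
      rw [hd, mul_zero] at e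
      have hm1 : (m : ℝ) ^ 2 - (1 : ℕ) ^ 2 ≠ 0 := by
        have : (4 : ℝ) ≤ m := by exact_mod_cast hm
        push_cast
        nlinarith
      exact mul_ne_zero hm1 (div_ne_zero (mul_ne_zero (hneg _ h1 h2.le).ne
        (besselJ_pos hm hμ0 (sq_div_four_le hc' hμ0 h2.le)).ne') hμ0.ne') e.symm
  · have hstep : ∀ m, 4 ≤ m → μ (m + 1) < μ m := by
      intro m hm
      obtain ⟨h1, h2, h3, -, -⟩ := hμ m hm
      obtain ⟨-, -, h3', h5', -⟩ := hμ (m + 1) (hm.trans m.le_succ)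
      have hW := besselW_succ_neg_of_eq_zero hj.1 hjc hc' hpos hneg hm h1 h2.le h3
      by_contra! hle
      rcases hle.eq_or_lt with h | h
      · rw [← h] at h3'
        exact hW.ne h3'
      · exact hW.not_gt (h5' _ (hj.1.trans h1) h)
    induction k, hmk using Nat.le_induction with
    | base => exact hstep m hm
    | succ k hk ih => exact (hstep k (by omega)).trans ih
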